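/- **Conventions.** Let $n\ge 0$. Simplices in $\mathbb R^n$ are non-degenerate; a simplex is identified with its vertex set and $\bar\sigma$ denotes the closed simplex. The fatness of a simplex $\tau$ is $\varphi(\tau)=\min_{\sigma}\mathrm{Vol}_l(\sigma)/(\operatorname{diam}\sigma)^l$, the minimum being over all faces $\sigma$ of $\tau$ (including $\tau$), $l=\dim\sigma$, with the volume of a vertex equal to $1$. An $n$-dimensional simplicial complex in $\mathbb R^n$ is one in which every simplex is a face of an $n$-simplex; it is $\varphi_0$-fat if all its simplices have fatness $\ge\varphi_0$. The angle $\measuredangle(\sigma_1,\sigma_2)\in[0,\pi/2]$ of two simplices is the angle between the planes they span: if $\dim\sigma_1+\dim\sigma_2\le n$, the least angle between a nonzero direction of the first plane and a nonzero direction of the second; if $\dim\sigma_1+\dim\sigma_2>n$, the least angle between nonzero vectors normal to the first and to the second plane (it is $\pi/2$ if there are no such pairs of vectors). For $\delta,\eta>0$, the simplices $\sigma_1,\sigma_2$ are *$\delta$-transverse at scale $\eta$* if (i) if $\bar\sigma_1\cap\bar\sigma_2\neq\emptyset$, then $\dim(\bar\sigma_1\cap\bar\sigma_2)=\max(0,\dim\sigma_1+\dim\sigma_2-n)$;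 (ii) $\delta<\measuredangle(\sigma_1,\sigma_2)$; (iii) $\operatorname{dist}(\bar\sigma_3,\bar\sigma_4)>\delta\,\eta$ for all faces $\sigma_3$ of $\sigma_1$ and $\sigma_4$ of $\sigma_2$ with $\dim\sigma_3+\dim\sigma_4<n$. **Proposition 3.5.** For all $n$ and all $\varphi_0,\delta,\varepsilon>0$ there is $\delta^*=\delta^*(n,\varphi_0,\delta,\varepsilon)>0$ with the following property. Let $K_1,K_2\subset\mathbb R^n$ be $n$-dimensional $\varphi_0$-fat simplicial complexes and let $d_1>0$ be such that every $n$-simplex of $K_1$ has diameter at most $d_1$ and every $n$-simplex of $K_2$ has diameter at least $d_1$. Let $v_0$ be a vertex of $K_1$, let $L_2=\{\sigma\in K_2 : \bar\sigma\cap B(v_0,2d_1)\ne\emptyset\}$ ($B$ the open ball), and let $\partial St(v_0)$ be the set of the simplices of $K_1$ that do not contain $v_0$ and are faces of a simplex containing $v_0$. Let $k\ge 0$ and suppose that every $k$-simplex $\tau\in\partial St(v_0)$ is $\delta$-transverse at scale $d_1$ to every $\sigma\in L_2$. Then there is $v_0^*\in\mathbb R^n$ with $\operatorname{dist}(v_0,v_0^*)<\varepsilon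 d_1$ such that, for every $(k+1)$-simplex $\tau$ of $K_1$ with vertex $v_0$, replacing the vertex $v_0$ of $\tau$ by $v_0^*$ and keeping its other vertices gives a non-degenerate $(k+1)$-simplex $\tau^*$ that is $\delta^*$-transverse at scale $d_1$ to every $\sigma\in L_2$. -/

import Mathlib

open MeasureTheory Module

noncomputable section

namespace FatSimplex

/-- Euclidean `n`-space. A simplex in it is given by its finite vertex set `s`; the closed simplex is
`convexHull ℝ s`, its faces are the nonempty subsets of `s`. -/
abbrev Eucl (n : ℕ) : Type := EuclideanSpace ℝ (Fin n)

/-- The dimension of the simplex with (nonempty, affinely independent) vertex set `s`. -/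
def sdim {n : ℕ} (s : Finset (Eucl n)) : ℕ := s.card - 1

/-- The closed simplex with vertex set `s`. -/
def body {n : ℕ} (s : Finset (Eucl n)) : Set (Eucl n) := convexHull ℝ (s : Set (Eucl n))

/-- The `l`-dimensional Euclidean volume of an `l`-simplex (equal to `1` for a vertex). -/
def vol {n : ℕ} (s : Finset (Eucl n)) : ℝ := (μHE[sdim s] (body s)).toReal

/-- The fatness of a simplex: the infimum over all its faces `t`, of every dimension `l`, of
`Vol_l(t) / diam(t) ^ l`. -/
def fatness {n : ℕ} (s : Finset (Eucl n)) : ℝ :=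
  sInf ((fun t : Finset (Eucl n) => vol t / Metric.diam (body t) ^ sdim t) ''
    {t | t ⊆ s ∧ t.Nonempty})

/-- A `φ₀`-fat complex: all its simplices have fatness at least `φ₀`. -/
def IsFat {n : ℕ} (φ₀ : ℝ) (K : Geometry.SimplicialComplex ℝ (Eucl n)) : Prop :=
  ∀ s ∈ K.faces, φ₀ ≤ fatness s

/-- `K` is a (purely) `n`-dimensional complex in `n`-space: every simplex is a face of an
`n`-simplex of `K`. -/
def IsFullDim {n : ℕ} (K : Geometry.SimplicialComplex ℝ (Eucl n)) : Prop :=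
  ∀ s ∈ K.faces, ∃ t ∈ K.faces, s ⊆ t ∧ sdim t = n

/-- The least angle between a nonzero vector of `U` and a nonzero vector of `W`. When both subspaces
are nonzero this lies in `[0, π/2]` (replace a vector by its negative), so inserting `π/2` only fixes
the value `π/2` when one of them is zero. -/
def minAngle {n : ℕ} (U W : Submodule ℝ (Eucl n)) : ℝ :=
  sInf (insert (Real.pi / 2)
    {θ | ∃ u ∈ U, ∃ w ∈ W, u ≠ 0 ∧ w ≠ 0 ∧ θ = InnerProductGeometry.angle u w})

/-- The direction of the affine plane spanned by a simplex. -/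
def dir {n : ℕ} (s : Finset (Eucl n)) : Submodule ℝ (Eucl n) := vectorSpan ℝ (s : Set (Eucl n))

/-- The angle between two simplices, i.e. between the planes they span: if the dimensions add up to
at most `n`, the least angle between their directions; otherwise the least angle between their
normal spaces (as for the dihedral angle of two hyperplanes). For planes in general position this is
the least angle between directions of the two planes orthogonal to their common directions; it is `0`
exactly when the planes are not in general position. -/
def simplexAngle {n : ℕ} (s t : Finset (Eucl n)) : ℝ :=
  if sdim s + sdim t ≤ n then minAngle (dir s) (dir t) else minAngle (dir s)ᗮ (dir t)ᗮ

/-- `s` and `t` are `δ`-transverse, at the length scale `η` of the complex to which the first one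
belongs:
(i) if the closed simplices meet, their intersection has dimension `max (0, dim s + dim t - n)`
(truncated subtraction of natural numbers);
(ii) `0 < δ <` the angle between them;
(iii) faces whose dimensions add up to less than `n` are at distance greater than `δ * η`
(closed simplices are compact, so this is the same for all pairs of points as for the infimum). -/
structure Transverse {n : ℕ} (δ η : ℝ) (s t : Finset (Eucl n)) : Prop where
  dim_inter : (body s ∩ body t).Nonempty →
    finrank ℝ (vectorSpan ℝ (body s ∩ body t)) = sdim s + sdim t - n
  delta_pos : 0 < δ
  delta_lt_angle : δ < simplexAngle s t
  far_faces : ∀ s' ⊆ s, ∀ t' ⊆ t, s'.Nonempty → t'.Nonempty → sdim s' + sdim t' < n →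
    ∀ x ∈ body s', ∀ y ∈ body t', δ * η < dist x y

/-- The simplices of the star of `v` that have `v` as a vertex, i.e. `St(v) \ ∂St(v)`. -/
def openStar {n : ℕ} (K : Geometry.SimplicialComplex ℝ (Eucl n)) (v : Eucl n) :
    Set (Finset (Eucl n)) :=
  {s ∈ K.faces | v ∈ s}

/-- The boundary `∂St(v)` of the closed star of `v`: the simplices not containing `v` that are faces
of a simplex containing `v`. -/
def starBoundary {n : ℕ} (K : Geometry.SimplicialComplex ℝ (Eucl n)) (v : Eucl n) :
    Set (Finset (Eucl n)) :=
  {s ∈ K.faces | v ∉ s ∧ ∃ t ∈ openStar K v, s ⊆ t}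

/-- The simplices of `K` whose closed body meets the open ball `B(v, r)`. -/
def nearby {n : ℕ} (K : Geometry.SimplicialComplex ℝ (Eucl n)) (v : Eucl n) (r : ℝ) :
    Set (Finset (Eucl n)) :=
  {s ∈ K.faces | (body s ∩ Metric.ball v r).Nonempty}

open Classical in
/-- The simplex `τ*` obtained from `s` by replacing the vertex `v` by `v'`, all other vertices being
kept fixed. -/
def moveVertex {n : ℕ} (v v' : Eucl n) (s : Finset (Eucl n)) : Finset (Eucl n) :=
  s.image (fun x => if x = v then v' else x)

end FatSimplex

end

/-!
The new apex `v₀'` has to avoid finitely many slabs around affine hyperplanes, and their number is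
bounded in terms of `n` and `φ₀`.

*Condition (iii)* (`lt_dist_of_farFrom`). Let `ρ` be a face of `τ` opposite to `v₀` and `t` a face of
a simplex of `L₂`. If the cone over `ρ` with apex `v₀'` has dimension less than `n - dim t`, then `ρ`
and `t` have at most `n` vertices together, so they lie in a hyperplane. A point of the cone close to
`t` cannot be close to `ρ`, which is far from `t` by hypothesis; hence it involves `v₀'` with a definite
weight, which is impossible when `v₀'` is far from that hyperplane.

*Condition (ii)* (`lt_simplexAngle_insert`). Angles are replaced by the inequality
`c * ‖u‖ ≤ ‖u - w‖` (`Separated`). While the dimensions add up to at most `n`, the inequality survives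
if `v₀'` is far from the plane through the opposite face parallel to both simplices
(`Separated.sup_span`). When the opposite face has complementary dimension, separation passes to
normal spaces (`Separated.orthogonal`), and beyond that the normal spaces only shrink.

*Condition (i)* (`finrank_inter_of_disjoint_faces`) is a consequence of (iii): an extreme point of the
intersection of two simplices lies in the interiors of two faces whose directions meet trivially, and
by (iii) they are complementary, which allows a perturbation into both relative interiors.

The number of slabs is bounded by comparing volumes (`card_mul_le_of_isFat`): fat `n`-simplices near
`v₀` contain essentially disjoint pieces of comparable volume inside a ball. Finally a ball contains a point that
avoids `N` slabs by `4⁻ᴺ` times its radius (`exists_farFrom`), by shrinking the ball `N` times.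
-/

namespace FatSimplex

/-! ### Relative interiors and the dimension of an intersection -/

open scoped Classical in
theorem exists_weights_of_mem_vectorSpan {E : Type*} [AddCommGroup E] [Module ℝ E] {s : Finset E}
    {u : E} (hu : u ∈ vectorSpan ℝ (s : Set E)) :
    ∃ c : E → ℝ, ∑ i ∈ s, c i = 0 ∧ ∑ i ∈ s, c i • i = u := by
  rw [vectorSpan_def] at hu
  induction hu using Submodule.span_induction with
  | mem x hx =>
    obtain ⟨a, ha, b, hb, rfl⟩ := hx
    refine ⟨fun i => (if i = a then 1 else 0) - (if i = b then 1 else 0), ?_, ?_⟩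
    · simp_all
    · simp_all [sub_smul]
  | zero => exact ⟨0, by simp, by simp⟩
  | add x y _ _ hx hy =>
    obtain ⟨c, hc, rfl⟩ := hx
    obtain ⟨d, hd, rfl⟩ := hy
    exact ⟨c + d, by simp [Finset.sum_add_distrib, hc, hd],
      by simp [Finset.sum_add_distrib, add_smul]⟩
  | smul a x _ hx =>
    obtain ⟨c, hc, rfl⟩ := hx
    exact ⟨a • c, by simp [← Finset.mul_sum, hc], by simp [Finset.smul_sum, mul_smul]⟩

/-- `x` is a convex combination of the points of `s` in which every weight is positive. When `s` is
affinely independent this says that `x` lies in the relative interior of the simplex `s`. -/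
def RelInt {n : ℕ} (s : Finset (Eucl n)) (x : Eucl n) : Prop :=
  ∃ w : Eucl n → ℝ, (∀ i ∈ s, 0 < w i) ∧ ∑ i ∈ s, w i = 1 ∧ ∑ i ∈ s, w i • i = x

variable {n : ℕ}

theorem RelInt.mem_body {s : Finset (Eucl n)} {x : Eucl n} (h : RelInt s x) : x ∈ body s := by
  obtain ⟨w, hw, h1, hx⟩ := h
  exact Finset.mem_convexHull'.2 ⟨w, fun i hi => (hw i hi).le, h1, hx⟩

/-- Every point of a closed simplex lies in the relative interior of one of its faces. -/
theorem exists_relInt_of_mem_body {s : Finset (Eucl n)} {x : Eucl n} (h : x ∈ body s) :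
    ∃ t ⊆ s, t.Nonempty ∧ RelInt t x := by
  obtain ⟨w, hw, h1, hx⟩ := Finset.mem_convexHull'.1 h
  have key : ∀ i ∈ s, i ∉ s.filter (fun i => 0 < w i) → w i = 0 := fun i hi hn => by
    simp only [Finset.mem_filter, not_and, not_lt] at hn
    exact le_antisymm (hn hi) (hw i hi)
  have e1 : ∑ i ∈ s.filter (fun i => 0 < w i), w i = 1 := by
    rw [← h1]; exact Finset.sum_subset (Finset.filter_subset _ _) key
  refine ⟨s.filter (fun i => 0 < w i), Finset.filter_subset _ _, ?_, w, by simp, e1, ?_⟩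
  · by_contra hne
    rw [Finset.not_nonempty_iff_eq_empty] at hne
    simp [hne] at e1
  · rw [← hx]
    exact Finset.sum_subset (Finset.filter_subset _ _) fun i hi hn => by simp [key i hi hn]

theorem exists_relInt {s : Finset (Eucl n)} (hs : s.Nonempty) : ∃ x, RelInt s x := by
  have : (0 : ℝ) < s.card := by exact_mod_cast hs.card_pos
  exact ⟨_, fun _ => (s.card : ℝ)⁻¹, fun _ _ => by positivity, by simp [this.ne'], rfl⟩

theorem RelInt.eventually_add_smul {s : Finset (Eucl n)} {x u : Eucl n} (h : RelInt s x)
    (hu : u ∈ dir s) : ∀ᶠ θ : ℝ in nhds 0, RelInt s (x + θ • u) := by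
  obtain ⟨w, hw, h1, rfl⟩ := h
  obtain ⟨c, hc, rfl⟩ := exists_weights_of_mem_vectorSpan hu
  have : ∀ i ∈ s, ∀ᶠ θ : ℝ in nhds 0, 0 < w i + θ * c i := fun i hi => by
    have : ContinuousAt (fun θ : ℝ => w i + θ * c i) 0 := by fun_prop
    exact this.eventually (lt_mem_nhds (by simpa using hw i hi))
  filter_upwards [(Filter.eventually_all_finset s).2 this] with θ hθ
  exact ⟨fun i => w i + θ * c i, hθ, by simp [Finset.sum_add_distrib, ← Finset.mul_sum, hc, h1],
    by simp [Finset.sum_add_distrib, add_smul, Finset.smul_sum, mul_smul]⟩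

/-- Moving from a point of a face towards a relatively interior point of the simplex leads
immediately into the relative interior. -/
theorem RelInt.combo {s t : Finset (Eucl n)} (hts : t ⊆ s) {x p : Eucl n} (hx : RelInt t x)
    (hp : RelInt s p) {θ : ℝ} (h0 : 0 < θ) (h1 : θ < 1) :
    RelInt s ((1 - θ) • x + θ • p) := by
  classical
  obtain ⟨w, hw, hw1, rfl⟩ := hx
  obtain ⟨v, hv, hv1, rfl⟩ := hp
  have e : ∀ i ∈ s, i ∉ t → (if i ∈ t then w i else 0) = 0 := by simp_all
  have e1 : ∑ i ∈ s, (if i ∈ t then w i else 0) = 1 := by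
    rw [← Finset.sum_subset hts e, ← hw1]
    exact Finset.sum_congr rfl (by simp_all)
  have e2 : ∑ i ∈ s, (if i ∈ t then w i else 0) • i = ∑ i ∈ t, w i • i := by
    rw [← Finset.sum_subset hts (fun i hi hn => by simp [hn])]
    exact Finset.sum_congr rfl (by simp_all)
  refine ⟨fun i => (1 - θ) * (if i ∈ t then w i else 0) + θ * v i, fun i hi => ?_, ?_, ?_⟩
  · have h2 := mul_pos h0 (hv i hi)
    have h3 : 0 ≤ (1 - θ) * (if i ∈ t then w i else 0) := by
      refine mul_nonneg (by linarith) ?_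
      split_ifs with h
      exacts [(hw i h).le, le_rfl]
    linarith
  · rw [Finset.sum_add_distrib, ← Finset.mul_sum, ← Finset.mul_sum, e1, hv1]; ring
  · simp only [add_smul, Finset.sum_add_distrib, mul_smul, ← Finset.smul_sum, e2]

theorem sub_mem_dir {s : Finset (Eucl n)} {x y : Eucl n} (hx : x ∈ body s) (hy : y ∈ body s) :
    x - y ∈ dir s := by
  have := AffineSubspace.vsub_mem_direction (convexHull_subset_affineSpan _ hx)
    (convexHull_subset_affineSpan _ hy)
  rwa [direction_affineSpan] at this

theorem finrank_dir {s : Finset (Eucl n)} (hs : s.Nonempty)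
    (ha : AffineIndependent ℝ ((↑) : s → Eucl n)) : finrank ℝ (dir s) = sdim s := by
  have h := ha.finrank_vectorSpan (n := sdim s)
    (by simp only [Fintype.card_coe, sdim]; have := hs.card_pos; omega)
  rwa [Subtype.range_coe_subtype, show {x | x ∈ s} = (s : Set (Eucl n)) from rfl] at h

theorem affineIndependent_of_subset {s t : Finset (Eucl n)} (hts : t ⊆ s)
    (ha : AffineIndependent ℝ ((↑) : s → Eucl n)) : AffineIndependent ℝ ((↑) : t → Eucl n) :=
  ha.mono (s := (t : Set (Eucl n))) (t := (s : Set (Eucl n))) (by exact_mod_cast hts)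

theorem isCompact_body (s : Finset (Eucl n)) : IsCompact (body s) :=
  s.finite_toSet.isCompact_convexHull ℝ

/-- If faces of `s` and `t` whose dimensions add up to less than `n` are always disjoint, then
`s` and `t` are in general position: an intersection, if nonempty, has the expected dimension.

An extreme point of the intersection lies in the relative interiors of faces `s'`, `t'` whose
directions meet trivially, hence span the whole space because their dimensions add up to at least
`n`. So a small displacement along these two faces brings the relative interiors of `s` and `t`
together. -/
theorem finrank_inter_of_disjoint_faces {s t : Finset (Eucl n)}
    (hs : AffineIndependent ℝ ((↑) : s → Eucl n)) (ht : AffineIndependent ℝ ((↑) : t → Eucl n))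
    (far : ∀ s' ⊆ s, ∀ t' ⊆ t, s'.Nonempty → t'.Nonempty → sdim s' + sdim t' < n →
      Disjoint (body s') (body t'))
    (hne : (body s ∩ body t).Nonempty) :
    finrank ℝ (vectorSpan ℝ (body s ∩ body t)) = sdim s + sdim t - n := by
  have hcomp : IsCompact (body s ∩ body t) :=
    (isCompact_body s).inter (isCompact_body t)
  obtain ⟨x, hx⟩ := hcomp.extremePoints_nonempty hne
  obtain ⟨s', hs's, hs'n, hxs⟩ := exists_relInt_of_mem_body hx.1.1
  obtain ⟨t', ht't, ht'n, hxt⟩ := exists_relInt_of_mem_body hx.1.2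
  have hsn := hs'n.mono hs's
  have htn := ht'n.mono ht't
  have hge : n ≤ sdim s' + sdim t' := by
    by_contra! hlt
    exact Set.disjoint_left.1 (far s' hs's t' ht't hs'n ht'n hlt) hxs.mem_body hxt.mem_body
  have hmono : ∀ {a b : Finset (Eucl n)}, a ⊆ b → body a ⊆ body b := fun h =>
    convexHull_mono (by exact_mod_cast h)
  have hinf : dir s' ⊓ dir t' = ⊥ := by
    rw [Submodule.eq_bot_iff]
    rintro u ⟨hus, hut⟩
    have hev := (hxs.eventually_add_smul hus).and (hxt.eventually_add_smul hut)
    have hev' := (hxs.eventually_add_smul (neg_mem hus)).and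
      (hxt.eventually_add_smul (neg_mem hut))
    obtain ⟨θ, ⟨⟨h1, h2⟩, h3, h4⟩, hθ⟩ :=
      (((hev.and hev').filter_mono nhdsWithin_le_nhds).and
        (self_mem_nhdsWithin : Set.Ioi (0 : ℝ) ∈ nhdsWithin 0 (Set.Ioi 0))).exists
    have hmem : x ∈ openSegment ℝ (x + θ • u) (x + θ • (-u)) :=
      ⟨1 / 2, 1 / 2, by norm_num, by norm_num, by norm_num, by module⟩
    have := hx.2 ⟨hmono hs's h1.mem_body, hmono ht't h2.mem_body⟩
      ⟨hmono hs's h3.mem_body, hmono ht't h4.mem_body⟩ hmem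
    have h0 : θ • u = 0 := by simpa using this
    exact (smul_eq_zero.1 h0).resolve_left (ne_of_gt hθ)
  have hsup : dir s' ⊔ dir t' = ⊤ := by
    refine Submodule.eq_top_of_finrank_eq (le_antisymm (Submodule.finrank_le _) ?_)
    have := Submodule.finrank_sup_add_finrank_inf_eq (dir s') (dir t')
    rw [hinf, finrank_bot, finrank_dir hs'n (affineIndependent_of_subset hs's hs),
      finrank_dir ht'n (affineIndependent_of_subset ht't ht)] at this
    simp only [finrank_euclideanSpace, Fintype.card_fin]
    omega
  have hdir : ∀ {a b : Finset (Eucl n)}, a ⊆ b → dir a ≤ dir b := fun h =>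
    vectorSpan_mono ℝ (by exact_mod_cast h)
  have hsup' : dir s ⊔ dir t = ⊤ := top_le_iff.1 (hsup ▸ sup_le_sup (hdir hs's) (hdir ht't))
  -- a common point `z` of the two relative interiors
  obtain ⟨p, hp⟩ := exists_relInt hsn
  obtain ⟨q, hq⟩ := exists_relInt htn
  obtain ⟨a, ha, b, hb, hab⟩ := Submodule.mem_sup.1
    (show p - q ∈ dir s' ⊔ dir t' by rw [hsup]; trivial)
  have hcont : Filter.Tendsto (fun θ : ℝ => θ / (1 - θ)) (nhds 0) (nhds 0) := by
    have : ContinuousAt (fun θ : ℝ => θ / (1 - θ)) 0 := by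
      apply ContinuousAt.div <;> first | fun_prop | norm_num
    simpa [ContinuousAt] using this
  have hev := hcont.eventually ((hxs.eventually_add_smul (neg_mem ha)).and
    (hxt.eventually_add_smul hb))
  obtain ⟨θ, ⟨⟨h1, h2⟩, hlt⟩, hθ⟩ :=
    (((hev.and (gt_mem_nhds one_pos)).filter_mono nhdsWithin_le_nhds).and
      (self_mem_nhdsWithin : Set.Ioi (0 : ℝ) ∈ nhdsWithin 0 (Set.Ioi 0))).exists
  have hθ1 : 1 - θ ≠ 0 := by linarith
  have hzs := h1.combo hs's hp hθ hlt
  have hzt := h2.combo ht't hq hθ hlt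
  have hzz : (1 - θ) • (x + (θ / (1 - θ)) • -a) + θ • p =
      (1 - θ) • (x + (θ / (1 - θ)) • b) + θ • q := by
    rw [smul_add, smul_add, smul_smul, smul_smul, mul_div_cancel₀ _ hθ1,
      show p = q + (a + b) by rw [hab]; abel]
    module
  rw [← hzz] at hzt
  set z := (1 - θ) • (x + (θ / (1 - θ)) • -a) + θ • p
  have hspan : vectorSpan ℝ (body s ∩ body t) = dir s ⊓ dir t := by
    apply le_antisymm
    · rw [vectorSpan_def, Submodule.span_le]
      rintro _ ⟨y, hy, y', hy', rfl⟩
      exact ⟨sub_mem_dir hy.1 hy'.1, sub_mem_dir hy.2 hy'.2⟩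
    · rintro u ⟨hus, hut⟩
      obtain ⟨θ, ⟨h1, h2⟩, hθ⟩ :=
        ((((hzs.eventually_add_smul hus).and (hzt.eventually_add_smul hut)).filter_mono
          nhdsWithin_le_nhds).and
          (self_mem_nhdsWithin : Set.Ioi (0 : ℝ) ∈ nhdsWithin 0 (Set.Ioi 0))).exists
      have := vsub_mem_vectorSpan ℝ (s := body s ∩ body t) ⟨h1.mem_body, h2.mem_body⟩
        ⟨hzs.mem_body, hzt.mem_body⟩
      rw [vsub_eq_sub, add_sub_cancel_left] at this
      exact (Submodule.smul_mem_iff _ (ne_of_gt hθ)).1 this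
  have := Submodule.finrank_sup_add_finrank_inf_eq (dir s) (dir t)
  rw [hsup', finrank_top, finrank_dir hsn hs, finrank_dir htn ht, finrank_euclideanSpace,
    Fintype.card_fin] at this
  rw [hspan]
  omega

/-! ### Avoiding slabs around affine subspaces -/

/-- Some unit vector normal to `S` witnesses that `x` is at distance at least `h` from `S`: the point
`x` lies outside the open slab of half-width `h` around a hyperplane containing `S`. -/
def FarFrom (h : ℝ) (S : AffineSubspace ℝ (Eucl n)) (x : Eucl n) : Prop :=
  ∃ ν : Eucl n, ‖ν‖ = 1 ∧ (∀ d ∈ S.direction, inner ℝ ν d = 0) ∧ ∀ z ∈ S, h ≤ |inner ℝ ν (x - z)|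

theorem FarFrom.mono {h h' : ℝ} (hh : h' ≤ h) {S : AffineSubspace ℝ (Eucl n)} {x : Eucl n}
    (H : FarFrom h S x) : FarFrom h' S x := by
  obtain ⟨ν, h1, h2, h3⟩ := H
  exact ⟨ν, h1, h2, fun z hz => hh.trans (h3 z hz)⟩

theorem exists_unit_normal {W : Submodule ℝ (Eucl n)} (hW : W ≠ ⊤) :
    ∃ ν : Eucl n, ‖ν‖ = 1 ∧ ∀ d ∈ W, inner ℝ ν d = 0 := by
  have : Wᗮ ≠ ⊥ := fun h => hW ((Submodule.orthogonal_eq_bot_iff).1 h)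
  obtain ⟨u, hu, hu0⟩ := Submodule.exists_mem_ne_zero_of_ne_bot this
  have hn : ‖u‖ ≠ 0 := norm_ne_zero_iff.2 hu0
  refine ⟨‖u‖⁻¹ • u, by rw [norm_smul, norm_inv, norm_norm, inv_mul_cancel₀ hn], fun d hd => ?_⟩
  rw [inner_smul_left, Submodule.inner_left_of_mem_orthogonal hd hu, mul_zero]

/-- The centre `v`, moved by half the radius along the normal of `S` and away from `S`, is the centre of a
smaller ball that avoids a slab around `S`. -/
theorem exists_ball_farFrom (hn : 0 < n) {S : AffineSubspace ℝ (Eucl n)} (hS : S ≠ ⊤) (v : Eucl n)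
    {r : ℝ} (hr : 0 < r) :
    ∃ x, Metric.ball x (r / 4) ⊆ Metric.ball v r ∧ ∀ y ∈ Metric.ball x (r / 4),
      FarFrom (r / 4) S y := by
  have hdir : S.direction ≠ ⊤ := by
    intro h
    rcases S.eq_bot_or_nonempty with rfl | hne
    · rw [AffineSubspace.direction_bot] at h
      have := congrArg (fun W : Submodule ℝ (Eucl n) => finrank ℝ W) h
      simp at this
      omega
    · exact hS ((AffineSubspace.direction_eq_top_iff_of_nonempty hne).1 h)
  obtain ⟨ν, hν, hνd⟩ := exists_unit_normal hdir
  have hball : ∀ σ : ℝ, |σ| = r / 2 →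
      Metric.ball (v + σ • ν) (r / 4) ⊆ Metric.ball v r := by
    intro σ hσ
    refine Metric.ball_subset_ball' ?_
    rw [dist_eq_norm, add_sub_cancel_left, norm_smul, hν, Real.norm_eq_abs, hσ]
    linarith
  have hin : ∀ (x y : Eucl n), y ∈ Metric.ball x (r / 4) → |inner ℝ ν (y - x)| ≤ r / 4 := by
    intro x y hy
    refine (abs_real_inner_le_norm _ _).trans ?_
    rw [hν, one_mul, ← dist_eq_norm]
    exact (Metric.mem_ball.1 hy).le
  -- the inner products with `ν` of `v - z`, for `z ∈ S`, all coincide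
  have hconst : ∀ z ∈ S, ∀ z' ∈ S, inner ℝ ν (v - z) = inner ℝ ν (v - z') := by
    intro z hz z' hz'
    have := hνd _ (AffineSubspace.vsub_mem_direction hz' hz)
    rw [vsub_eq_sub] at this
    rw [show v - z = (v - z') + (z' - z) by abel, inner_add_right, this, add_zero]
  have hνν : inner ℝ ν ν = (1 : ℝ) := by rw [real_inner_self_eq_norm_sq, hν]; norm_num
  by_cases hsgn : ∀ z ∈ S, 0 ≤ inner ℝ ν (v - z)
  · refine ⟨v + (r / 2) • ν, hball _ (abs_of_pos (by positivity)), fun y hy =>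
      ⟨ν, hν, hνd, fun z hz => ?_⟩⟩
    have h1 := (abs_le.1 (hin _ y hy)).1
    have h2 := hsgn z hz
    refine le_trans ?_ (le_abs_self _)
    rw [show y - z = (y - (v + (r / 2) • ν)) + (v - z) + (r / 2) • ν by abel, inner_add_right,
      inner_add_right, inner_smul_right, hνν]
    linarith
  · push Not at hsgn
    obtain ⟨z₀, hz₀, hneg⟩ := hsgn
    refine ⟨v + (-(r / 2)) • ν, hball _ (by rw [abs_neg, abs_of_pos (by positivity)]), fun y hy =>
      ⟨ν, hν, hνd, fun z hz => ?_⟩⟩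
    have h1 := (abs_le.1 (hin _ y hy)).2
    have h2 := hconst z hz z₀ hz₀
    refine le_trans ?_ (neg_le_abs _)
    rw [show y - z = (y - (v + (-(r / 2)) • ν)) + (v - z) + (-(r / 2)) • ν by abel, inner_add_right,
      inner_add_right, inner_smul_right, hνν]
    linarith

/-- A ball contains a point that stays away from finitely many proper affine subspaces, by an amount
that depends on the radius of the ball and on the number of subspaces only. -/
theorem exists_farFrom (hn : 0 < n) {ι : Type*} (I : Finset ι) (S : ι → AffineSubspace ℝ (Eucl n))
    (v : Eucl n) {r : ℝ} (hr : 0 < r) :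
    ∃ x ∈ Metric.ball v r, ∀ i ∈ I, S i ≠ ⊤ → FarFrom (r / 4 ^ I.card) (S i) x := by
  classical
  suffices ∃ x, Metric.ball x (r / 4 ^ I.card) ⊆ Metric.ball v r ∧
      ∀ y ∈ Metric.ball x (r / 4 ^ I.card), ∀ i ∈ I, S i ≠ ⊤ → FarFrom (r / 4 ^ I.card) (S i) y by
    obtain ⟨x, hx, h⟩ := this
    have : x ∈ Metric.ball x (r / 4 ^ I.card) := Metric.mem_ball_self (by positivity)
    exact ⟨x, hx this, h x this⟩
  induction I using Finset.induction_on with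
  | empty => exact ⟨v, by simp, by simp⟩
  | insert i I hi ih =>
    obtain ⟨x, hx, h⟩ := ih
    have hpos : 0 < r / 4 ^ I.card := by positivity
    have hle : r / 4 ^ I.card / 4 ≤ r / 4 ^ I.card := by linarith
    rw [Finset.card_insert_of_notMem hi, pow_succ, ← div_div]
    by_cases hS : S i = ⊤
    · have hsub := Metric.ball_subset_ball (x := x) hle
      refine ⟨x, hsub.trans hx, fun y hy j hj hjS => ?_⟩
      rcases Finset.mem_insert.1 hj with rfl | hj
      · exact absurd hS hjS
      · exact (h y (hsub hy) j hj hjS).mono hle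
    · obtain ⟨x', hsub, hx'⟩ := exists_ball_farFrom hn hS x hpos
      refine ⟨x', hsub.trans hx, fun y hy j hj hjS => ?_⟩
      rcases Finset.mem_insert.1 hj with rfl | hj
      · exact hx' y hy
      · exact (h y (hsub hy) j hj hjS).mono hle

/-! ### Angles and separation of subspaces -/

/-- The subspaces `U` and `W` are quantitatively separated: a vector of `U` has distance at least
`c` times its norm from `W`. -/
def Separated (c : ℝ) (U W : Submodule ℝ (Eucl n)) : Prop :=
  ∀ u ∈ U, ∀ w ∈ W, c * ‖u‖ ≤ ‖u - w‖

theorem Separated.mono {c c' : ℝ} (hc : c' ≤ c) {U W : Submodule ℝ (Eucl n)}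
    (h : Separated c U W) : Separated c' U W := fun u hu w hw =>
  (mul_le_mul_of_nonneg_right hc (norm_nonneg u)).trans (h u hu w hw)

theorem Separated.inf_eq_bot {c : ℝ} (hc : 0 < c) {U W : Submodule ℝ (Eucl n)}
    (h : Separated c U W) : U ⊓ W = ⊥ := by
  rw [Submodule.eq_bot_iff]
  rintro u ⟨hu, hw⟩
  have := h u hu u hw
  rw [sub_self, norm_zero] at this
  exact norm_le_zero_iff.1 (nonpos_of_mul_nonpos_right this hc)

theorem minAngle_le_angle {U W : Submodule ℝ (Eucl n)} {u w : Eucl n} (hu : u ∈ U) (hw : w ∈ W)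
    (hu0 : u ≠ 0) (hw0 : w ≠ 0) : minAngle U W ≤ InnerProductGeometry.angle u w := by
  refine csInf_le ⟨0, ?_⟩ (Or.inr ⟨u, hu, w, hw, hu0, hw0, rfl⟩)
  rintro _ (rfl | ⟨u, -, w, -, -, -, rfl⟩)
  · positivity
  · exact InnerProductGeometry.angle_nonneg _ _

theorem separated_of_lt_minAngle {U W : Submodule ℝ (Eucl n)} {δ : ℝ} (hδ : 0 < δ) (hδ1 : δ ≤ 1)
    (h : δ < minAngle U W) : Separated (Real.sin δ) U W := by
  intro u hu w hw
  have hpi := Real.pi_gt_three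
  have hsin : 0 ≤ Real.sin δ := Real.sin_nonneg_of_nonneg_of_le_pi hδ.le (by linarith)
  by_cases hu0 : u = 0
  · simp [hu0]
  by_cases hw0 : w = 0
  · rw [hw0, sub_zero]
    exact mul_le_of_le_one_left (norm_nonneg _) (Real.sin_le_one _)
  have h1 := h.trans_le (minAngle_le_angle hu hw hu0 hw0)
  have hcos : inner ℝ u w ≤ Real.cos δ * (‖u‖ * ‖w‖) := by
    rw [← InnerProductGeometry.cos_angle_mul_norm_mul_norm]
    exact mul_le_mul_of_nonneg_right (Real.cos_le_cos_of_nonneg_of_le_pi hδ.le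
      (InnerProductGeometry.angle_le_pi _ _) h1.le) (by positivity)
  refine abs_le_of_sq_le_sq' ?_ (norm_nonneg _) |>.2
  rw [norm_sub_sq_real, mul_pow, Real.sin_sq]
  nlinarith [sq_nonneg (‖w‖ - Real.cos δ * ‖u‖)]

theorem Separated.le_minAngle {U W : Submodule ℝ (Eucl n)} {c : ℝ} (hc1 : c ≤ 1)
    (h : Separated c U W) : c ≤ minAngle U W := by
  have hpi := Real.pi_gt_three
  refine le_csInf ⟨_, Or.inl rfl⟩ ?_
  rintro _ (rfl | ⟨u, hu, w, hw, hu0, hw0, rfl⟩)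
  · linarith
  set θ := InnerProductGeometry.angle u w with hθ
  have hθ0 : 0 ≤ θ := InnerProductGeometry.angle_nonneg _ _
  by_contra! hlt
  have hun : 0 < ‖u‖ := norm_pos_iff.2 hu0
  have hwn : 0 < ‖w‖ := norm_pos_iff.2 hw0
  -- compare `u` with its orthogonal projection to the line spanned by `w`
  have h1 := h u hu ((Real.cos θ * ‖u‖ / ‖w‖) • w) (W.smul_mem _ hw)
  have hin : inner ℝ u w = Real.cos θ * (‖u‖ * ‖w‖) :=
    (InnerProductGeometry.cos_angle_mul_norm_mul_norm u w).symm
  have h2 : ‖u - (Real.cos θ * ‖u‖ / ‖w‖) • w‖ ^ 2 = (Real.sin θ * ‖u‖) ^ 2 := by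
    rw [norm_sub_sq_real, inner_smul_right, hin, norm_smul, mul_pow, mul_pow, Real.sin_sq,
      Real.norm_eq_abs, sq_abs]
    field_simp
    ring
  have hsin : 0 ≤ Real.sin θ := Real.sin_nonneg_of_nonneg_of_le_pi hθ0 (by linarith)
  have h3 : ‖u - (Real.cos θ * ‖u‖ / ‖w‖) • w‖ = Real.sin θ * ‖u‖ :=
    (sq_eq_sq₀ (norm_nonneg _) (by positivity)).1 h2
  rw [h3] at h1
  have h4 := le_of_mul_le_mul_right h1 hun
  linarith [Real.sin_le hθ0]

/-- For complementary subspaces, separation passes to the orthogonal complements. -/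
theorem Separated.orthogonal {U W : Submodule ℝ (Eucl n)} {c : ℝ} (hc : 0 < c) (hc1 : c ≤ 1)
    (h : Separated c U W) (hsup : U ⊔ W = ⊤) : Separated (c / 2) Uᗮ Wᗮ := by
  intro x hx y hy
  obtain ⟨u, hu, w, hw, hx'⟩ := Submodule.mem_sup.1 (show x ∈ U ⊔ W by rw [hsup]; trivial)
  have h1 := h u hu (-w) (neg_mem hw)
  rw [sub_neg_eq_add, hx'] at h1
  have h2 : ‖w‖ ≤ ‖x‖ + ‖u‖ := by
    rw [show w = x - u by rw [← hx']; abel]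
    exact norm_sub_le _ _
  have h3 : ‖x‖ * ‖x‖ ≤ ‖x - y‖ * ‖w‖ := by
    rw [← real_inner_self_eq_norm_mul_norm]
    have e : inner ℝ x x = inner ℝ (x - y) w := by
      nth_rewrite 2 [← hx']
      rw [inner_add_right, Submodule.inner_left_of_mem_orthogonal hu hx, inner_sub_left,
        Submodule.inner_left_of_mem_orthogonal hw hy]
      ring
    rw [e]
    exact real_inner_le_norm _ _
  rcases eq_or_lt_of_le (norm_nonneg x) with h0 | h0
  · rw [← h0, mul_zero]; exact norm_nonneg _
  have h4 : c * ‖w‖ ≤ 2 * ‖x‖ := by nlinarith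
  have h5 : c * ‖x‖ * ‖x‖ ≤ 2 * ‖x - y‖ * ‖x‖ := by
    nlinarith [mul_le_mul_of_nonneg_left h4 (norm_nonneg (x - y))]
  linarith [le_of_mul_le_mul_right h5 h0]

/-- Adding to `U` a vector `e` that sticks out of `U ⊔ W` keeps it separated from `W`. -/
theorem Separated.sup_span {U W : Submodule ℝ (Eucl n)} {c h M : ℝ} (hc : 0 < c) (hc1 : c ≤ 1)
    (hh : 0 < h) (H : Separated c U W) {ν e : Eucl n} (hν : ‖ν‖ = 1)
    (hνU : ∀ u ∈ U, inner ℝ ν u = 0) (hνW : ∀ w ∈ W, inner ℝ ν w = 0)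
    (he : ‖e‖ ≤ M) (hνe : h ≤ |inner ℝ ν e|) :
    Separated (c * h / (h + 2 * M)) (U ⊔ Submodule.span ℝ {e}) W := by
  intro x hx w hw
  have hM : 0 ≤ M := (norm_nonneg e).trans he
  obtain ⟨u, hu, e', he', rfl⟩ := Submodule.mem_sup.1 hx
  obtain ⟨s, rfl⟩ := Submodule.mem_span_singleton.1 he'
  set D := ‖u + s • e - w‖ with hD
  have h1 : |s| * h ≤ D := by
    have : |inner ℝ ν (u + s • e - w)| ≤ D := by
      have := abs_real_inner_le_norm ν (u + s • e - w)
      rwa [hν, one_mul] at this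
    rw [inner_sub_right, inner_add_right, hνU u hu, hνW w hw, inner_smul_right, sub_zero, zero_add,
      abs_mul] at this
    exact (mul_le_mul_of_nonneg_left hνe (abs_nonneg s)).trans this
  have hse : ‖s • e‖ ≤ |s| * M := by
    rw [norm_smul, Real.norm_eq_abs]
    exact mul_le_mul_of_nonneg_left he (abs_nonneg s)
  have h2 : ‖u - w‖ ≤ D + |s| * M := by
    rw [show u - w = (u + s • e - w) - s • e by abel]
    exact (norm_sub_le _ _).trans (by linarith)
  have h3 : ‖u + s • e‖ ≤ ‖u‖ + |s| * M := (norm_add_le _ _).trans (by linarith)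
  have h4 := H u hu w hw
  have h5 : c * ‖u + s • e‖ ≤ D + 2 * (|s| * M) := by
    have : 0 ≤ |s| * M := by positivity
    nlinarith
  rw [div_mul_eq_mul_div, div_le_iff₀ (by positivity)]
  nlinarith [mul_le_mul_of_nonneg_right h1 hM]

/-! ### Transversality of a cone -/

theorem affineIndependent_insert {a : Finset (Eucl n)} {v : Eucl n}
    (ha : AffineIndependent ℝ ((↑) : a → Eucl n)) (hv : v ∉ affineSpan ℝ (a : Set (Eucl n))) :
    AffineIndependent ℝ ((↑) : ↥(insert v a : Finset (Eucl n)) → Eucl n) := by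
  have h : AffineIndependent ℝ (fun x : (insert v (a : Set (Eucl n)) : Set (Eucl n)) =>
      (x : Eucl n)) := by
    refine AffineIndependent.affineIndependent_of_notMem_span (i := ⟨v, Set.mem_insert _ _⟩) ?_ ?_
    · let f : {y : (insert v (a : Set (Eucl n)) : Set (Eucl n)) // y ≠ ⟨v, Set.mem_insert _ _⟩} ↪
          (a : Set (Eucl n)) :=
        ⟨fun y => ⟨y.1.1, y.1.2.resolve_left fun h => y.2 (Subtype.ext h)⟩, fun y z h =>
          Subtype.ext (Subtype.ext (Subtype.mk.inj h))⟩
      have ha' : AffineIndependent ℝ (fun x : (a : Set (Eucl n)) => (x : Eucl n)) := ha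
      have := ha'.comp_embedding f
      exact this
    · refine fun h => hv (affineSpan_mono ℝ ?_ h)
      rintro _ ⟨y, hy, rfl⟩
      exact y.2.resolve_left fun h => hy (Subtype.ext h)
  rw [← Finset.coe_insert] at h
  exact h

theorem FarFrom.notMem {h : ℝ} (hh : 0 < h) {S : AffineSubspace ℝ (Eucl n)} {x : Eucl n}
    (H : FarFrom h S x) : x ∉ S := by
  obtain ⟨ν, -, -, h3⟩ := H
  intro hx
  have := h3 x hx
  rw [sub_self, inner_zero_right, abs_zero] at this
  linarith

/-- A point `x` of the simplex spanned by `v` and `ρ` is far from `t`: if it is close to `ρ` because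
`ρ` is far from `t`, otherwise because `v` is far from the plane spanned by `ρ` and `t`. -/
theorem lt_dist_of_farFrom {ρ t : Finset (Eucl n)} {v : Eucl n} {δ η d : ℝ} (hδ : 0 < δ)
    (hδ1 : δ ≤ 1) (hη : 0 < η) (hη1 : η ≤ 1) (hd : 0 < d)
    (hv : FarFrom (η * d) (affineSpan ℝ ((ρ ∪ t : Finset (Eucl n)) : Set (Eucl n))) v)
    (hnear : ∀ r ∈ body ρ, ‖v - r‖ ≤ 2 * d)
    (hfar : ∀ r ∈ body ρ, ∀ y ∈ body t, δ * d < dist r y)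
    {x y : Eucl n} (hx : x ∈ body (insert v ρ)) (hy : y ∈ body t) :
    δ * η / 10 * d < dist x y := by
  obtain ⟨ν, hν, hνd, hνv⟩ := hv
  have hmem : ∀ {s : Finset (Eucl n)}, s ⊆ ρ ∪ t → ∀ z ∈ body s,
      z ∈ affineSpan ℝ ((ρ ∪ t : Finset (Eucl n)) : Set (Eucl n)) := fun hs z hz =>
    affineSpan_mono ℝ (by exact_mod_cast hs) (convexHull_subset_affineSpan _ hz)
  have hyS := hmem Finset.subset_union_right y hy
  have hvy := hνv y hyS
  have hnu : ∀ z : Eucl n, |inner ℝ ν z| ≤ ‖z‖ := fun z => by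
    simpa [hν] using abs_real_inner_le_norm ν z
  have hδη : δ * η ≤ η := mul_le_of_le_one_left hη.le hδ1
  have hηd : 0 < η * d := by positivity
  have hδηd : 0 < δ * η * d := by positivity
  rw [dist_eq_norm]
  rcases ρ.eq_empty_or_nonempty with rfl | hρ
  · have hxv : x = v := by simpa [body] using hx
    subst hxv
    have := hvy.trans (hnu _)
    nlinarith [mul_le_mul_of_nonneg_right hδη hd.le]
  · have hx' : x ∈ convexJoin ℝ {v} (body ρ) := by
      rw [body, Finset.coe_insert, convexHull_insert (by exact_mod_cast hρ)] at hx
      exact hx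
    simp only [convexJoin_singleton_left, Set.mem_iUnion] at hx'
    obtain ⟨r, hr, l, m, hl, hm, hlm, rfl⟩ := hx'
    have hrS := hmem Finset.subset_union_left r hr
    have hm' : m = 1 - l := by linarith
    subst hm'
    set D := ‖l • v + (1 - l) • r - y‖ with hD
    have h1 : l * (η * d) ≤ D := by
      have hry : inner ℝ ν (r - y) = 0 := hνd _ (AffineSubspace.vsub_mem_direction hrS hyS)
      have h2 := hnu (l • v + (1 - l) • r - y)
      rw [show l • v + (1 - l) • r - y = l • (v - r) + (r - y) by module, inner_add_right, hry,
        add_zero, inner_smul_right, abs_mul, abs_of_nonneg hl] at h2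
      rw [hD, show l • v + (1 - l) • r - y = l • (v - r) + (r - y) by module]
      exact (mul_le_mul_of_nonneg_left (hνv r hrS) hl).trans h2
    have h2 : δ * d < D + l * (2 * d) := by
      have h3 := hfar r hr y hy
      rw [dist_eq_norm, show r - y = (l • v + (1 - l) • r - y) - l • (v - r) by module] at h3
      refine h3.trans_le ((norm_sub_le _ _).trans ?_)
      rw [norm_smul, Real.norm_of_nonneg hl]
      have := mul_le_mul_of_nonneg_left (hnear r hr) hl
      linarith
    have hD0 : 0 ≤ D := norm_nonneg _
    nlinarith [mul_lt_mul_of_pos_left h2 hη, mul_le_of_le_one_left hD0 hη1]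

theorem dir_insert_le {a : Finset (Eucl n)} {p : Eucl n} (hp : p ∈ a) (v : Eucl n) :
    dir (insert v a) ≤ dir a ⊔ Submodule.span ℝ {v - p} := by
  have hp' : p ∈ ((insert v a : Finset (Eucl n)) : Set (Eucl n)) := by simp [hp]
  rw [dir, vectorSpan_eq_span_vsub_set_right ℝ hp', Submodule.span_le]
  rintro _ ⟨y, hy, rfl⟩
  rcases Finset.mem_insert.1 (Finset.mem_coe.1 hy) with rfl | hy
  · exact Submodule.mem_sup_right (Submodule.mem_span_singleton_self _)
  · exact Submodule.mem_sup_left (vsub_mem_vectorSpan ℝ hy hp)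

theorem Separated.anti {c : ℝ} {U U' W : Submodule ℝ (Eucl n)} (hU : U' ≤ U)
    (h : Separated c U W) : Separated c U' W := fun u hu w hw => h u (hU hu) w hw

/-- The angle condition for the cone over `a` with apex `v`. There are three regimes: as long as the
dimensions add up to at most `n`, the apex is far from the plane through `a` parallel to `a` and `b`;
if `a` and `b` have complementary dimensions, one passes to normal spaces; beyond that, the normal
space of the cone is contained in that of `a`. -/
theorem lt_simplexAngle_insert {a b : Finset (Eucl n)} {v : Eucl n} {δ η d : ℝ}
    (hδ : 0 < δ) (hδ1 : δ ≤ 1) (hη : 0 < η) (hη1 : η ≤ 1) (hd : 0 < d)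
    (han : a.Nonempty) (hbn : b.Nonempty) (hva : v ∉ a)
    (ha : AffineIndependent ℝ ((↑) : a → Eucl n)) (hb : AffineIndependent ℝ ((↑) : b → Eucl n))
    (H : δ < simplexAngle a b) (hnear : ∀ r ∈ body a, ‖v - r‖ ≤ 2 * d)
    (hv : dir a ⊔ dir b ≠ ⊤ → ∃ p ∈ a, FarFrom (η * d) (AffineSubspace.mk' p (dir a ⊔ dir b)) v) :
    Real.sin δ * η / 10 < simplexAngle (insert v a) b := by
  have hpi := Real.pi_gt_three
  have hsin : 0 < Real.sin δ := Real.sin_pos_of_pos_of_lt_pi hδ (by linarith)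
  have hsin1 : Real.sin δ ≤ 1 := Real.sin_le_one δ
  have hsη : Real.sin δ * η ≤ Real.sin δ := mul_le_of_le_one_right hsin.le hη1
  have hsη0 : 0 < Real.sin δ * η := by positivity
  have hdim : sdim (insert v a) = sdim a + 1 := by
    have := han.card_pos
    simp only [sdim, Finset.card_insert_of_notMem hva]
    omega
  have hsum := Submodule.finrank_sup_add_finrank_inf_eq (dir a) (dir b)
  rw [finrank_dir han ha, finrank_dir hbn hb] at hsum
  unfold simplexAngle at H ⊢
  rw [hdim]
  have hle : dir a ≤ dir (insert v a) := vectorSpan_mono ℝ (by simp)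
  by_cases h1 : sdim a + 1 + sdim b ≤ n
  · rw [if_pos h1]
    rw [if_pos (by omega)] at H
    have hsep := separated_of_lt_minAngle hδ hδ1 H
    have hne : dir a ⊔ dir b ≠ ⊤ := fun h => by
      rw [h, finrank_top, finrank_euclideanSpace, Fintype.card_fin] at hsum
      omega
    obtain ⟨p, hp, ν, hν, hνd, hνv⟩ := hv hne
    rw [AffineSubspace.direction_mk'] at hνd
    have hsep' := hsep.sup_span hsin hsin1 (by positivity : 0 < η * d) hν
      (fun u hu => hνd u (Submodule.mem_sup_left hu))
      (fun u hu => hνd u (Submodule.mem_sup_right hu))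
      (hnear p (subset_convexHull ℝ _ hp)) (hνv p (AffineSubspace.self_mem_mk' _ _))
    have hc : Real.sin δ * η / 5 ≤ Real.sin δ * (η * d) / (η * d + 2 * (2 * d)) := by
      rw [div_le_div_iff₀ (by norm_num) (by positivity)]
      have : 0 < Real.sin δ * η * d := by positivity
      nlinarith
    have := ((hsep'.mono hc).anti (dir_insert_le hp v)).le_minAngle (by linarith)
    linarith
  · rw [if_neg h1]
    have hperp : (dir (insert v a))ᗮ ≤ (dir a)ᗮ := Submodule.orthogonal_le hle
    have key : Separated (Real.sin δ / 2) (dir a)ᗮ (dir b)ᗮ := by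
      by_cases h2 : sdim a + sdim b ≤ n
      · rw [if_pos h2] at H
        have hsep := separated_of_lt_minAngle hδ hδ1 H
        refine hsep.orthogonal hsin hsin1 (Submodule.eq_top_of_finrank_eq ?_)
        rw [hsep.inf_eq_bot hsin, finrank_bot] at hsum
        rw [finrank_euclideanSpace, Fintype.card_fin]
        omega
      · rw [if_neg h2] at H
        exact (separated_of_lt_minAngle hδ hδ1 H).mono (by linarith)
    have := (key.anti hperp).le_minAngle (by linarith)
    linarith

/-- The cone over `a` with apex `v` inherits transversality to `b` from `a`, provided that `v` stays
away from the finitely many planes spanned by few vertices of `a` and `b`, and from the plane through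
`a` parallel to `a` and `b`. -/
theorem Transverse.cone {a b : Finset (Eucl n)} {v : Eucl n} {δ η d : ℝ}
    (hδ : 0 < δ) (hδ1 : δ ≤ 1) (hη : 0 < η) (hη1 : η ≤ 1) (hd : 0 < d)
    (han : a.Nonempty) (hbn : b.Nonempty) (hva : v ∉ a)
    (ha : AffineIndependent ℝ ((↑) : ↥(insert v a : Finset (Eucl n)) → Eucl n))
    (hb : AffineIndependent ℝ ((↑) : b → Eucl n))
    (H : Transverse δ d a b) (hnear : ∀ r ∈ body a, ‖v - r‖ ≤ 2 * d)
    (hv : dir a ⊔ dir b ≠ ⊤ → ∃ p ∈ a, FarFrom (η * d) (AffineSubspace.mk' p (dir a ⊔ dir b)) v)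
    (hv' : ∀ a' ⊆ a, ∀ b' ⊆ b, a'.card + b'.card ≤ n →
      FarFrom (η * d) (affineSpan ℝ ((a' ∪ b' : Finset (Eucl n)) : Set (Eucl n))) v) :
    Transverse (Real.sin δ * η / 10) d (insert v a) b := by
  have hpi := Real.pi_gt_three
  have hsin : 0 < Real.sin δ := Real.sin_pos_of_pos_of_lt_pi hδ (by linarith)
  have hpos : 0 < Real.sin δ * η / 10 := by positivity
  have hsδ : Real.sin δ * η ≤ δ * η := mul_le_mul_of_nonneg_right (Real.sin_le hδ.le) hη.le
  have hle1 : Real.sin δ * η / 10 * d ≤ δ * η / 10 * d :=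
    mul_le_mul_of_nonneg_right (by linarith) hd.le
  have hle2 : δ * η / 10 * d ≤ δ * d := by
    refine mul_le_mul_of_nonneg_right ?_ hd.le
    nlinarith [mul_le_of_le_one_right hδ.le hη1]
  have far : ∀ s' ⊆ insert v a, ∀ t' ⊆ b, s'.Nonempty → t'.Nonempty → sdim s' + sdim t' < n →
      ∀ x ∈ body s', ∀ y ∈ body t', Real.sin δ * η / 10 * d < dist x y := by
    intro s' hs' t' ht' hs'n ht'n hlt x hx y hy
    by_cases hvs : v ∈ s'
    · have hsub : s'.erase v ⊆ a := by
        rwa [← Finset.subset_insert_iff]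
      rw [← Finset.insert_erase hvs] at hx
      have hc := Finset.card_erase_add_one hvs
      have ht0 := ht'n.card_pos
      simp only [sdim] at hlt
      refine hle1.trans_lt (lt_dist_of_farFrom hδ hδ1 hη hη1 hd
        (hv' _ hsub _ ht' (by omega)) (fun r hr => hnear r ?_) (fun r hr z hz => ?_) hx hy)
      · exact convexHull_mono (by exact_mod_cast hsub) hr
      · have hen : (s'.erase v).Nonempty := by
          rw [Finset.nonempty_iff_ne_empty]
          intro h0
          rw [h0] at hr
          simp [body] at hr
        exact H.far_faces _ hsub _ ht' hen ht'n (by simp only [sdim]; omega) r hr z hz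
    · have hsub : s' ⊆ a := (Finset.subset_insert_iff_of_notMem hvs).1 hs'
      exact (hle1.trans hle2).trans_lt (H.far_faces _ hsub _ ht' hs'n ht'n hlt x hx y hy)
  refine ⟨finrank_inter_of_disjoint_faces ha hb ?_, hpos, ?_, far⟩
  · intro s' hs' t' ht' hs'n ht'n hlt
    rw [Set.disjoint_left]
    intro x hx hx'
    have := far s' hs' t' ht' hs'n ht'n hlt x hx x hx'
    rw [dist_self] at this
    have : 0 < Real.sin δ * η / 10 * d := by positivity
    linarith
  · exact lt_simplexAngle_insert hδ hδ1 hη hη1 hd han hbn hva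
      (affineIndependent_of_subset (Finset.subset_insert _ _) ha) hb H.delta_lt_angle hnear hv

theorem Transverse.mono {a b : Finset (Eucl n)} {δ δ' d : ℝ} (hδ' : 0 < δ') (h : δ' ≤ δ)
    (hd : 0 < d) (H : Transverse δ d a b) : Transverse δ' d a b :=
  ⟨H.dim_inter, hδ', h.trans_lt H.delta_lt_angle, fun s' hs' t' ht' h1 h2 h3 x hx y hy =>
    (mul_le_mul_of_nonneg_right h hd.le).trans_lt (H.far_faces s' hs' t' ht' h1 h2 h3 x hx y hy)⟩

/-! ### Counting fat simplices -/

theorem le_vol_of_isFat {φ₀ : ℝ} {K : Geometry.SimplicialComplex ℝ (Eucl n)} (hK : IsFat φ₀ K)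
    {s : Finset (Eucl n)} (hs : s ∈ K.faces) :
    φ₀ ≤ vol s / Metric.diam (body s) ^ sdim s := by
  refine (hK s hs).trans (csInf_le ⟨0, ?_⟩ ⟨s, ⟨subset_rfl, K.nonempty_of_mem_faces hs⟩, rfl⟩)
  rintro _ ⟨t, -, rfl⟩
  exact div_nonneg ENNReal.toReal_nonneg (pow_nonneg Metric.diam_nonneg _)

/-- A degenerate diameter would make the quotient in the definition of the fatness a division by zero,
hence `0`. -/
theorem diam_pos_of_isFat (hn : 0 < n) {φ₀ : ℝ} (hφ : 0 < φ₀)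
    {K : Geometry.SimplicialComplex ℝ (Eucl n)} (hK : IsFat φ₀ K)
    {s : Finset (Eucl n)} (hs : s ∈ K.faces) (hsn : sdim s = n) :
    0 < Metric.diam (body s) := by
  refine lt_of_le_of_ne Metric.diam_nonneg fun h => ?_
  have := le_vol_of_isFat hK hs
  rw [← h, hsn, zero_pow hn.ne', div_zero] at this
  linarith

theorem affineSpan_ne_top_of_card_le (hn : 0 < n) {s : Finset (Eucl n)} (hs : s.card ≤ n) :
    affineSpan ℝ (s : Set (Eucl n)) ≠ ⊤ := by
  classical
  intro h
  have h1 := congrArg AffineSubspace.direction h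
  rw [direction_affineSpan, AffineSubspace.direction_top] at h1
  have h2 : finrank ℝ (vectorSpan ℝ (s : Set (Eucl n))) = n := by
    rw [h1, finrank_top, finrank_euclideanSpace, Fintype.card_fin]
  rcases s.eq_empty_or_nonempty with rfl | hne
  · rw [Finset.coe_empty, vectorSpan_empty, finrank_bot] at h2
    omega
  · have h3 := finrank_vectorSpan_image_finset_le ℝ id s (n := s.card - 1)
      (by have := hne.card_pos; omega)
    rw [Finset.image_id, h2] at h3
    have := hne.card_pos
    omega

/-- Distinct `n`-simplices of a complex in `n`-space overlap in a null set only. -/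
theorem volume_inter_body (hn : 0 < n) (K : Geometry.SimplicialComplex ℝ (Eucl n))
    {s t : Finset (Eucl n)} (hs : s ∈ K.faces) (ht : t ∈ K.faces) (hsn : sdim s = n)
    (htn : sdim t = n) (hst : s ≠ t) : volume (body s ∩ body t) = 0 := by
  classical
  have hcs : s.card = n + 1 := by
    have := (K.nonempty_of_mem_faces hs).card_pos
    simp only [sdim] at hsn; omega
  have hct : t.card = n + 1 := by
    have := (K.nonempty_of_mem_faces ht).card_pos
    simp only [sdim] at htn; omega
  have hlt : (s ∩ t).card < s.card := by
    refine Finset.card_lt_card (Finset.inter_subset_left.ssubset_of_ne fun h => hst ?_)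
    exact Finset.eq_of_subset_of_card_le (Finset.inter_eq_left.1 h) (by omega)
  refine measure_mono_null ((K.inter_subset_convexHull hs ht).trans ?_)
    (Measure.addHaar_affineSubspace volume _
      (affineSpan_ne_top_of_card_le hn (s := s ∩ t) (by omega)))
  rw [← Finset.coe_inter]
  exact convexHull_subset_affineSpan _

/-- Every simplex of a fat complex that meets a ball contains a homothetic copy of itself of
diameter `r` close to that ball, and the volumes of these copies add up. -/
theorem card_mul_le_of_isFat (hn : 0 < n) {φ₀ : ℝ}
    {K : Geometry.SimplicialComplex ℝ (Eucl n)} (hK : IsFat φ₀ K) (v : Eucl n) {r : ℝ} (hr : 0 < r)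
    (F : Finset (Finset (Eucl n)))
    (hF : ∀ s ∈ F, s ∈ K.faces ∧ sdim s = n ∧ r ≤ Metric.diam (body s) ∧
      ∃ p ∈ body s, dist p v ≤ 2 * r) :
    F.card * φ₀ ≤ 3 ^ n * (volume (Metric.ball (0 : Eucl n) 1)).toReal := by
  classical
  have hch : ∀ s : Finset (Eucl n), ∃ p, s ∈ F → p ∈ body s ∧ dist p v ≤ 2 * r := fun s => by
    by_cases hs : s ∈ F
    · obtain ⟨p, hp⟩ := (hF s hs).2.2.2
      exact ⟨p, fun _ => hp⟩
    · exact ⟨0, fun h => absurd h hs⟩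
  choose p hp using hch
  let c : Finset (Eucl n) → Set (Eucl n) := fun s =>
    AffineMap.homothety (p s) (r / Metric.diam (body s)) '' body s
  have hlam : ∀ s ∈ F, 0 < Metric.diam (body s) ∧ r / Metric.diam (body s) ≤ 1 := fun s hs => by
    have h := (hF s hs).2.2.1
    exact ⟨hr.trans_le h, div_le_one_of_le₀ h (hr.le.trans h)⟩
  have hcsub : ∀ s ∈ F, c s ⊆ body s := by
    rintro s hs _ ⟨y, hy, rfl⟩
    rw [AffineMap.homothety_eq_lineMap]
    exact (convex_convexHull ℝ _).lineMap_mem (hp s hs).1 hy ⟨by positivity, (hlam s hs).2⟩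
  have hcball : ∀ s ∈ F, c s ⊆ Metric.closedBall v (3 * r) := by
    rintro s hs _ ⟨y, hy, rfl⟩
    have h1 : dist (AffineMap.homothety (p s) (r / Metric.diam (body s)) y) (p s) ≤ r := by
      rw [AffineMap.homothety_eq_lineMap, dist_lineMap_left, Real.norm_of_nonneg (by positivity)]
      have := Metric.dist_le_diam_of_mem (isCompact_body s).isBounded (hp s hs).1 hy
      calc r / Metric.diam (body s) * dist (p s) y
          ≤ r / Metric.diam (body s) * Metric.diam (body s) := by gcongr
        _ = r := div_mul_cancel₀ _ (hlam s hs).1.ne'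
    rw [Metric.mem_closedBall]
    linarith [dist_triangle (AffineMap.homothety (p s) (r / Metric.diam (body s)) y) (p s) v,
      (hp s hs).2]
  have hcmeas : ∀ s, MeasurableSet (c s) := fun s =>
    ((isCompact_body s).image (AffineMap.homothety (p s) _).continuous_of_finiteDimensional).measurableSet
  have hvol : ∀ s ∈ F, φ₀ * r ^ n ≤ (volume (c s)).toReal := by
    intro s hs
    have hd := (hlam s hs).1
    have h1 := le_vol_of_isFat hK (hF s hs).1
    rw [vol, (hF s hs).2.1, EuclideanSpace.euclideanHausdorffMeasure_eq_volume,
      le_div_iff₀ (by positivity)] at h1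
    rw [Measure.addHaar_image_homothety, ENNReal.toReal_mul, finrank_euclideanSpace,
      Fintype.card_fin, abs_of_nonneg (by positivity), ENNReal.toReal_ofReal (by positivity),
      div_pow, div_mul_eq_mul_div, le_div_iff₀ (by positivity)]
    nlinarith [mul_le_mul_of_nonneg_left h1 (pow_nonneg hr.le n)]
  have hsum : volume (⋃ s ∈ F, c s) = ∑ s ∈ F, volume (c s) := by
    refine measure_biUnion_finset₀ (fun s hs t ht hst => ?_)
      fun s _ => (hcmeas s).nullMeasurableSet
    exact measure_mono_null (Set.inter_subset_inter (hcsub s hs) (hcsub t ht))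
      (volume_inter_body hn K (hF s hs).1 (hF t ht).1 (hF s hs).2.1 (hF t ht).2.1 hst)
  have hfin : ∀ s ∈ F, volume (c s) ≠ ⊤ := fun s hs =>
    ((measure_mono (hcball s hs)).trans_lt measure_closedBall_lt_top).ne
  have hle : (∑ s ∈ F, volume (c s)).toReal ≤
      (3 * r) ^ n * (volume (Metric.ball (0 : Eucl n) 1)).toReal := by
    rw [← hsum]
    have h := ENNReal.toReal_mono measure_closedBall_lt_top.ne
      (measure_mono (μ := volume) (Set.iUnion₂_subset hcball))
    rwa [Measure.addHaar_closedBall _ _ (by positivity), ENNReal.toReal_mul,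
      finrank_euclideanSpace, Fintype.card_fin, ENNReal.toReal_ofReal (by positivity)] at h
  rw [ENNReal.toReal_sum hfin] at hle
  have hge := Finset.card_nsmul_le_sum F _ _ hvol
  rw [nsmul_eq_mul] at hge
  have : F.card * φ₀ * r ^ n ≤ 3 ^ n * (volume (Metric.ball (0 : Eucl n) 1)).toReal * r ^ n := by
    rw [mul_pow] at hle
    linarith
  exact le_of_mul_le_mul_right this (by positivity)

/-- If at most `N` of the `n`-simplices are relevant, then they have at most `N * 2 ^ (n + 1) + 1` faces,
where the empty face is always counted: with it, planes spanned by faces of two complexes include those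
spanned by a face of one of them alone. -/
theorem exists_finset_faces {A : Set (Finset (Eucl n))} {N : ℕ}
    (hA : ∀ F : Finset (Finset (Eucl n)), (F : Set (Finset (Eucl n))) ⊆ A → F.card ≤ N)
    (hdim : ∀ s ∈ A, sdim s = n) :
    ∃ B : Finset (Finset (Eucl n)), B.card ≤ N * 2 ^ (n + 1) + 1 ∧ ∅ ∈ B ∧
      ∀ s ∈ A, ∀ a ⊆ s, a ∈ B := by
  have hfin : A.Finite := by
    by_contra hinf
    obtain ⟨F, hF, hc⟩ := Set.Infinite.exists_subset_card_eq hinf (N + 1)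
    have := hA F hF
    omega
  refine ⟨insert ∅ (hfin.toFinset.biUnion Finset.powerset), ?_, Finset.mem_insert_self _ _,
    fun s hs a ha => Finset.mem_insert_of_mem
      (Finset.mem_biUnion.2 ⟨s, hfin.mem_toFinset.2 hs, Finset.mem_powerset.2 ha⟩)⟩
  refine (Finset.card_insert_le _ _).trans (Nat.add_le_add_right ?_ 1)
  refine (Finset.card_biUnion_le_card_mul _ _ (2 ^ (n + 1)) fun s hs => ?_).trans
    (Nat.mul_le_mul_right _ (hA _ (by simp)))
  rw [Finset.card_powerset]
  have := hdim s (hfin.mem_toFinset.1 hs)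
  simp only [sdim] at this
  exact Nat.pow_le_pow_right (by norm_num) (by omega)

theorem moveVertex_eq_insert {v v' : Eucl n} {s : Finset (Eucl n)} (hv : v ∈ s) :
    moveVertex v v' s = insert v' (s.erase v) := by
  ext x
  simp only [moveVertex, Finset.mem_image, Finset.mem_insert, Finset.mem_erase]
  constructor
  · rintro ⟨y, hy, rfl⟩
    split_ifs with h
    · exact Or.inl rfl
    · exact Or.inr ⟨h, hy⟩
  · rintro (rfl | ⟨h, hx⟩)
    · exact ⟨v, hv, if_pos rfl⟩
    · exact ⟨x, hx, if_neg h⟩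

/-- A bound for the number of `n`-simplices of a `φ₀`-fat complex that are close to a given point
at their own length scale. -/
noncomputable def simplexBound (n : ℕ) (φ₀ : ℝ) : ℕ :=
  ⌊3 ^ n * (volume (Metric.ball (0 : Eucl n) 1)).toReal / φ₀⌋₊

theorem card_le_simplexBound (hn : 0 < n) {φ₀ : ℝ} (hφ : 0 < φ₀)
    {K : Geometry.SimplicialComplex ℝ (Eucl n)} (hK : IsFat φ₀ K) (v : Eucl n) {r : ℝ} (hr : 0 < r)
    (F : Finset (Finset (Eucl n)))
    (hF : ∀ s ∈ F, s ∈ K.faces ∧ sdim s = n ∧ r ≤ Metric.diam (body s) ∧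
      ∃ p ∈ body s, dist p v ≤ 2 * r) : F.card ≤ simplexBound n φ₀ :=
  Nat.le_floor ((le_div_iff₀ hφ).2 (card_mul_le_of_isFat hn hK v hr F hF))

/-- There is no lower bound on the size of the simplices with a given vertex `v`, but homotheties centred
at `v` bring them to a common scale. -/
theorem card_star_le (hn : 0 < n) {φ₀ : ℝ} (hφ : 0 < φ₀)
    {K : Geometry.SimplicialComplex ℝ (Eucl n)} (hK : IsFat φ₀ K) (v : Eucl n)
    (F : Finset (Finset (Eucl n)))
    (hF : ∀ s ∈ F, s ∈ K.faces ∧ sdim s = n ∧ v ∈ s) : F.card ≤ simplexBound n φ₀ := by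
  rcases F.eq_empty_or_nonempty with rfl | hne
  · simp
  -- the simplices are compared at the scale of the smallest of their diameters
  obtain ⟨s₀, hs₀, hmin⟩ := F.exists_min_image (fun s => Metric.diam (body s)) hne
  have hr := diam_pos_of_isFat hn hφ hK (hF s₀ hs₀).1 (hF s₀ hs₀).2.1
  exact card_le_simplexBound hn hφ hK v hr F fun s hs =>
    ⟨(hF s hs).1, (hF s hs).2.1, hmin s hs, v,
      subset_convexHull ℝ _ (Finset.mem_coe.2 (hF s hs).2.2), by rw [dist_self]; positivity⟩

end FatSimplex

/-! ### Choice of the new vertex -/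

open FatSimplex in
theorem proposition3p5 (n : ℕ) (φ₀ δ ε : ℝ) (hφ₀ : 0 < φ₀) (hδ : 0 < δ) (hε : 0 < ε) :
    ∃ δ' : ℝ, 0 < δ' ∧
      ∀ (K₁ K₂ : Geometry.SimplicialComplex ℝ (FatSimplex.Eucl n)) (d₁ : ℝ),
        FatSimplex.IsFullDim K₁ → FatSimplex.IsFullDim K₂ →
        FatSimplex.IsFat φ₀ K₁ → FatSimplex.IsFat φ₀ K₂ →
        0 < d₁ →
        (∀ s ∈ K₁.faces, FatSimplex.sdim s = n → Metric.diam (FatSimplex.body s) ≤ d₁) →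
        (∀ t ∈ K₂.faces, FatSimplex.sdim t = n → d₁ ≤ Metric.diam (FatSimplex.body t)) →
        ∀ v₀ ∈ K₁.vertices, ∀ k : ℕ,
          (∀ τ ∈ FatSimplex.starBoundary K₁ v₀, FatSimplex.sdim τ = k →
            ∀ σ ∈ FatSimplex.nearby K₂ v₀ (2 * d₁), FatSimplex.Transverse δ d₁ τ σ) →
          ∃ v₀' : FatSimplex.Eucl n, dist v₀ v₀' < ε * d₁ ∧
            ∀ τ ∈ FatSimplex.openStar K₁ v₀, FatSimplex.sdim τ = k + 1 →
              AffineIndependent ℝ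
                ((↑) : FatSimplex.moveVertex v₀ v₀' τ → FatSimplex.Eucl n) ∧
              FatSimplex.sdim (FatSimplex.moveVertex v₀ v₀' τ) = k + 1 ∧
              ∀ σ ∈ FatSimplex.nearby K₂ v₀ (2 * d₁),
                FatSimplex.Transverse δ' d₁ (FatSimplex.moveVertex v₀ v₀' τ) σ := by
  rcases Nat.eq_zero_or_pos n with rfl | hn
  · -- in dimension `0` there are no simplices of positive dimension to consider
    refine ⟨1, one_pos, fun K₁ K₂ d₁ hK₁ _ _ _ hd _ _ v₀ _ k _ =>
      ⟨v₀, by rw [dist_self]; positivity, fun τ hτ hτk => ?_⟩⟩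
    obtain ⟨t, -, hst, ht⟩ := hK₁ τ hτ.1
    have := Finset.card_le_card hst
    simp only [sdim] at ht hτk
    omega
  have hpi := Real.pi_gt_three
  -- angles and displacements above `1` are of no use
  set δ₁ := min δ 1
  set ε₁ := min ε 1
  have hδ₁ : 0 < δ₁ := lt_min hδ one_pos
  have hδ₁1 : δ₁ ≤ 1 := min_le_right _ _
  have hε₁ : 0 < ε₁ := lt_min hε one_pos
  have hε₁1 : ε₁ ≤ 1 := min_le_right _ _
  set M := simplexBound n φ₀ * 2 ^ (n + 1) + 1
  set η := ε₁ / 4 ^ (M * M * 2) with hηdef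
  have hη : 0 < η := by positivity
  have hη1 : η ≤ 1 := (div_le_self hε₁.le (one_le_pow₀ (by norm_num))).trans hε₁1
  have hsin : 0 < Real.sin δ₁ := Real.sin_pos_of_pos_of_lt_pi hδ₁ (by linarith)
  refine ⟨Real.sin δ₁ * η / 10, by positivity, ?_⟩
  intro K₁ K₂ d₁ hdim₁ hdim₂ hfat₁ hfat₂ hd hdiam₁ hdiam₂ v₀ _ k H
  obtain ⟨A, hAc, -, hA⟩ := exists_finset_faces (N := simplexBound n φ₀)
    (A := {s | s ∈ K₁.faces ∧ sdim s = n ∧ v₀ ∈ s})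
    (fun F hF => card_star_le hn hφ₀ hfat₁ v₀ F fun s hs => hF hs) fun s hs => hs.2.1
  obtain ⟨B, hBc, hB0, hB⟩ := exists_finset_faces (N := simplexBound n φ₀)
    (A := {s | s ∈ K₂.faces ∧ sdim s = n ∧ (body s ∩ Metric.ball v₀ (2 * d₁)).Nonempty})
    (fun F hF => card_le_simplexBound hn hφ₀ hfat₂ v₀ hd F fun s hs => by
      obtain ⟨h1, h2, p, hp, hp'⟩ := hF hs
      exact ⟨h1, h2, hdiam₂ s h1 h2, p, hp, (Metric.mem_ball.1 hp').le⟩) fun s hs => hs.2.1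
  let S : (Finset (Eucl n) × Finset (Eucl n)) × Bool → AffineSubspace ℝ (Eucl n) := fun q =>
    if q.2 then affineSpan ℝ ((q.1.1 ∪ q.1.2 : Finset (Eucl n)) : Set (Eucl n))
    else AffineSubspace.mk' (Classical.epsilon (· ∈ q.1.1)) (dir q.1.1 ⊔ dir q.1.2)
  obtain ⟨v, hv, hfar⟩ := exists_farFrom hn ((A ×ˢ B) ×ˢ (Finset.univ : Finset Bool)) S v₀
    (by positivity : 0 < ε₁ * d₁)
  have hηle : η * d₁ ≤ ε₁ * d₁ / 4 ^ ((A ×ˢ B) ×ˢ (Finset.univ : Finset Bool)).card := by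
    rw [hηdef, div_mul_eq_mul_div]
    refine div_le_div_of_nonneg_left (by positivity) (by positivity)
      (pow_le_pow_right₀ (by norm_num) ?_)
    rw [Finset.card_product, Finset.card_product, Finset.card_univ, Fintype.card_bool]
    exact Nat.mul_le_mul_right _ (Nat.mul_le_mul hAc hBc)
  have hspan : ∀ a ∈ A, ∀ b ∈ B, a.card + b.card ≤ n →
      FarFrom (η * d₁) (affineSpan ℝ ((a ∪ b : Finset (Eucl n)) : Set (Eucl n))) v := by
    intro a ha b hb hab
    exact (hfar ((a, b), true) (by simp [ha, hb]) (affineSpan_ne_top_of_card_le hn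
      ((Finset.card_union_le a b).trans hab))).mono hηle
  rw [Metric.mem_ball] at hv
  refine ⟨v, ?_, fun τ hτ hτk => ?_⟩
  · rw [dist_comm]
    exact hv.trans_le (mul_le_mul_of_nonneg_right (min_le_left _ _) hd.le)
  obtain ⟨t, htK, hτt, htn⟩ := hdim₁ τ hτ.1
  have htA : ∀ a ⊆ τ, a ∈ A := fun a ha => hA t ⟨htK, htn, hτt hτ.2⟩ a (ha.trans hτt)
  rw [moveVertex_eq_insert hτ.2]
  set a := τ.erase v₀ with hadef
  have haτ : a ⊆ τ := Finset.erase_subset _ _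
  have hac : a.card + 1 = τ.card := Finset.card_erase_add_one hτ.2
  have htc := Finset.card_le_card hτt
  have hτk' := hτk
  simp only [sdim] at hτk' htn
  have han : a.Nonempty := Finset.card_pos.1 (by omega)
  have haK : a ∈ K₁.faces := K₁.down_closed hτ.1 haτ han
  have hvspan : v ∉ affineSpan ℝ (a : Set (Eucl n)) := by
    have := (hspan a (htA a haτ) ∅ hB0 (by rw [Finset.card_empty]; omega)).notMem (by positivity)
    rwa [Finset.union_empty] at this
  have hva : v ∉ a := fun h => hvspan (subset_affineSpan ℝ _ h)
  have haff := affineIndependent_insert (K₁.indep haK) hvspan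
  refine ⟨haff, by simp only [sdim, Finset.card_insert_of_notMem hva]; omega, fun σ hσ => ?_⟩
  have hT := H a ⟨haK, Finset.notMem_erase _ _, τ, hτ, haτ⟩ (by simp only [sdim]; omega) σ hσ
  obtain ⟨t', ht'K, hσt', ht'n⟩ := hdim₂ σ hσ.1
  have hσB : ∀ b ⊆ σ, b ∈ B := fun b hb => hB t' ⟨ht'K, ht'n, hσ.2.mono
    (Set.inter_subset_inter_left _ (convexHull_mono (by exact_mod_cast hσt')))⟩ b (hb.trans hσt')
  refine (hT.mono hδ₁ (min_le_left _ _) hd).cone hδ₁ hδ₁1 hη hη1 hd han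
    (K₂.nonempty_of_mem_faces hσ.1) hva haff (K₂.indep hσ.1) ?_ ?_ ?_
  · intro r hr
    have hbt : ∀ z ∈ body τ, z ∈ body t := fun z hz =>
      convexHull_mono (by exact_mod_cast hτt) hz
    have h1 : dist v₀ r ≤ d₁ := (Metric.dist_le_diam_of_mem (isCompact_body t).isBounded
      (hbt _ (subset_convexHull ℝ _ hτ.2))
      (hbt _ (convexHull_mono (by exact_mod_cast haτ) hr))).trans (hdiam₁ t htK htn)
    rw [← dist_eq_norm]
    have h2 : ε₁ * d₁ ≤ d₁ := mul_le_of_le_one_left hd.le hε₁1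
    linarith [dist_triangle v v₀ r]
  · intro hne
    refine ⟨Classical.epsilon (· ∈ a), Classical.epsilon_spec han, ?_⟩
    refine (hfar ((a, σ), false) (by simp [htA a haτ, hσB σ subset_rfl]) fun h => hne ?_).mono hηle
    have := congrArg AffineSubspace.direction h
    simpa [S] using this
  · intro a' ha' b' hb' hab
    exact hspan a' (htA a' (ha'.trans haτ)) b' (hσB b' hb') hab
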